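/- Let $\mathbb{RP}^1$ be the real projective line, with affine coordinate $x\mapsto[x:1]$ and $\infty=[1:0]$, and let $\Omega\mathbb{RP}^1$ be the space of continuous maps $f:\mathbb{RP}^1\to\mathbb{RP}^1$ with $f(\infty)=[1:1]$, with the compact-open topology. For an integer $n\ge 0$ let $\mathrm{RRat}_n(1)\subset\Omega\mathbb{RP}^1$ be the set of maps of the form $[x:1]\mapsto[p(x):q(x)]$, where $p,q\in\mathbb{R}[x]$ are monic polynomials of degree $n$ without common complex roots, and let $\mathrm{rat}_n(1)$ be the closure of $\mathrm{RRat}_n(1)$ in $\Omega\mathbb{RP}^1$ (the space of real rational maps $\mathbb{RP}^1\to\mathbb{RP}^1$). **Theorem.** For every integer $n\ge0$, the space $\mathrm{rat}_n(1)$ has exactly $n+1$ connected components. They are indexed by the topological degree: the topological degree of a map is constant on each component, and it induces a bijection from the set of connected components of $\mathrm{rat}_n(1)$ onto the set of integers $d$ with $-n\le d\le n$ and $d\equiv n\pmod 2$. Every connected component is contractible. -/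

import Mathlib

open scoped Polynomial

/-- The real projective line: lines through the origin in `ℝ²`. -/
abbrev RP1 : Type := Projectivization ℝ (Fin 2 → ℝ)

/-- The quotient topology coming from `ℝ² ∖ {0}`. -/
noncomputable instance instTopologicalSpaceRP1 : TopologicalSpace RP1 :=
  TopologicalSpace.coinduced
    (fun v : {v : Fin 2 → ℝ // v ≠ 0} => Projectivization.mk ℝ v.1 v.2) inferInstance

namespace RP1

theorem vec_one_right_ne_zero (x : ℝ) : (![x, 1] : Fin 2 → ℝ) ≠ 0 := by
  intro h
  simpa using congrFun h 1

theorem vec_one_left_ne_zero (x : ℝ) : (![1, x] : Fin 2 → ℝ) ≠ 0 := by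
  intro h
  simpa using congrFun h 0

theorem vec_cos_sin_ne_zero (t : ℝ) : (![Real.cos t, Real.sin t] : Fin 2 → ℝ) ≠ 0 := by
  intro h
  have h0 : Real.cos t = 0 := by simpa using congrFun h 0
  have h1 : Real.sin t = 0 := by simpa using congrFun h 1
  have := Real.sin_sq_add_cos_sq t
  simp [h0, h1] at this

/-- The point `[x : 1]` of the affine piece, with affine coordinate `x`. -/
noncomputable def affine (x : ℝ) : RP1 := Projectivization.mk ℝ ![x, 1] (vec_one_right_ne_zero x)

/-- The point at infinity `[1 : 0]`, the basepoint of the source. -/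
noncomputable def infty : RP1 := Projectivization.mk ℝ ![1, 0] (vec_one_left_ne_zero 0)

/-- The point `[1 : 1]`, the basepoint of the target. -/
noncomputable def base : RP1 := Projectivization.mk ℝ ![1, 1] (vec_one_left_ne_zero 1)

/-- The universal covering `ℝ → ℝP¹`, `θ ↦ [cos πθ : sin πθ]`, whose deck transformations are the
integer translations. -/
noncomputable def cover (θ : ℝ) : RP1 :=
  Projectivization.mk ℝ ![Real.cos (Real.pi * θ), Real.sin (Real.pi * θ)] (vec_cos_sin_ne_zero _)

/-- `f : ℝP¹ → ℝP¹` has topological degree `d`: it has a continuous lift `F` to the universal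
covering with `F (θ + 1) = F θ + d`. -/
def HasDegree (f : C(RP1, RP1)) (d : ℤ) : Prop :=
  ∃ F : ℝ → ℝ, Continuous F ∧ (∀ θ, f (cover θ) = cover (F θ)) ∧ ∀ θ, F (θ + 1) = F θ + d

end RP1

/-- `Ω ℝP¹`: continuous maps `ℝP¹ → ℝP¹` sending `∞` to `[1 : 1]`, with the topology induced by the
compact-open topology. -/
abbrev LoopRP1 : Type := {f : C(RP1, RP1) // f RP1.infty = RP1.base}

/-- The image in `Ω ℝP¹` of the basepoint-preserving, conjugation-equivariant rational maps
`ℂP¹ → ℂP¹` of degree exactly `n`. Such a map is `[p : q]` for a unique pair of monic real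
polynomials of degree `n` without common complex roots. -/
def realRat (n : ℕ) : Set LoopRP1 :=
  {f | ∃ p q : ℝ[X], p.Monic ∧ q.Monic ∧ p.natDegree = n ∧ q.natDegree = n ∧ IsCoprime p q ∧
    ∀ x : ℝ, ∃ h : (![p.eval x, q.eval x] : Fin 2 → ℝ) ≠ 0,
      f.1 (RP1.affine x) = Projectivization.mk ℝ ![p.eval x, q.eval x] h}

/-- The space of real rational maps `ℝP¹ → ℝP¹`: the closure of `realRat n` in `Ω ℝP¹`. -/
def ratClosure (n : ℕ) : Set LoopRP1 := closure (realRat n)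

/-!
The line `[v₀ : v₁]` corresponds to the point `(v₀ + i v₁) / (v₀ - i v₁)` of the circle. A coprime
pair `(p, q)` thus becomes `x ↦ (p + iq) / (p - iq)`: up to the factor `i`, the product of
`(x - c) / (x - conj c)` over the roots `c` of `p + iq`, no two of which are conjugate. In the disc
coordinate, each root in the lower half-plane contributes a Blaschke factor and each root in the
upper half-plane the inverse of one, so a map of degree `d` is a quotient of Blaschke products with
disjoint zero multisets `A` and `B`, where `|A| + |B| = n` and `|A| - |B| = d`.

Dividing by `z ^ d` leaves `exp (iU)`, where `U` extends to the disc as the imaginary part of a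
holomorphic function. By the maximum principle, uniform convergence on the circle is the same as
uniform convergence of `U` on the disc, so the closure can be taken there. Replacing `U` by
`z ↦ U (wz)` only multiplies all zeros by `conj w`, so for `w ≠ 0` it keeps `A` and `B` disjoint;
letting `w` run from `1` to `0` contracts the closure of each degree class. There are finitely many
such closures, and they are disjoint since a map has only one degree, so they are the components.
-/

open Complex (I exp)
open Real (cos sin cos_add_pi sin_add_pi pi_ne_zero two_pi_pos)
open scoped Complex.UnitDisc ComplexConjugate Real UpperHalfPlane

namespace RP1

/-- The identification of `ℝ²` with `ℂ` through which lines become points of the circle. -/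
noncomputable def toComplex : (Fin 2 → ℝ) ≃ₗ[ℝ] ℂ := Complex.basisOneI.equivFun.symm

theorem toComplex_apply (v : Fin 2 → ℝ) : toComplex v = v 0 + v 1 * I := by
  simp [toComplex, Module.Basis.equivFun_symm_apply]

theorem conj_toComplex_ne_zero {v : Fin 2 → ℝ} (hv : v ≠ 0) : conj (toComplex v) ≠ 0 := by
  simpa using hv

/-- The point `(v₀ + i v₁) / (v₀ - i v₁)` of the circle attached to the line `[v₀ : v₁]`. -/
noncomputable def toCircle : RP1 → Circle :=
  Projectivization.lift
    (fun v => Circle.ofConjDivSelf (conj (toComplex v)) (conj_toComplex_ne_zero v.2)) (by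
      rintro ⟨v, hv⟩ ⟨w, hw⟩ t rfl
      have ht : (t : ℂ) ≠ 0 := fun h => hv (by simp [Complex.ofReal_eq_zero.1 h])
      ext
      simp [mul_div_mul_left _ _ ht])

theorem coe_toCircle_mk (v : Fin 2 → ℝ) (hv : v ≠ 0) :
    (toCircle (Projectivization.mk ℝ v hv) : ℂ) = toComplex v / conj (toComplex v) := by
  simp [toCircle]

theorem continuous_toCircle : Continuous toCircle := by
  have hcont : Continuous fun v : {v : Fin 2 → ℝ // v ≠ 0} => toComplex v :=
    toComplex.toLinearMap.continuous_of_finiteDimensional.comp continuous_subtype_val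
  refine continuous_coinduced_dom.2 (continuous_induced_rng.2 ?_)
  refine (hcont.div (Complex.continuous_conj.comp hcont) fun v =>
    conj_toComplex_ne_zero v.2).congr fun v => (coe_toCircle_mk v.1 v.2).symm

theorem toCircle_cover (θ : ℝ) : toCircle (cover θ) = Circle.exp (2 * π * θ) := by
  have hexp : toComplex ![cos (π * θ), sin (π * θ)] = exp ((π * θ : ℝ) * I) := by
    simp [toComplex_apply, Complex.exp_mul_I]
  ext
  rw [cover, coe_toCircle_mk, hexp, ← Complex.exp_conj, ← Complex.exp_sub, Circle.coe_exp]
  congr 1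
  simp only [map_mul, Complex.conj_ofReal, Complex.conj_I]
  push_cast
  ring

theorem continuous_cover : Continuous cover := by
  refine continuous_coinduced_rng.comp (f := fun θ : ℝ =>
    (⟨![cos (π * θ), sin (π * θ)], vec_cos_sin_ne_zero _⟩ : {v : Fin 2 → ℝ // v ≠ 0})) ?_
  fun_prop

theorem periodic_cover : Function.Periodic cover 1 := fun θ => by
  rw [cover, cover, Projectivization.mk_eq_mk_iff']
  refine ⟨-1, ?_⟩
  simp [mul_add, cos_add_pi, sin_add_pi]

theorem cover_surjective : Function.Surjective cover := by
  rintro ⟨v, hv⟩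
  set z := toComplex v with hz
  have hnorm : (‖z‖ : ℂ) ≠ 0 := by simpa [hz] using hv
  refine ⟨z.arg / π, (Projectivization.mk_eq_mk_iff' ℝ _ _ _ _).2 ⟨‖z‖⁻¹, ?_⟩⟩
  apply toComplex.injective
  rw [map_smul, ← hz, Complex.real_smul, mul_div_cancel₀ _ pi_ne_zero, Complex.ofReal_inv,
    inv_mul_eq_iff_eq_mul₀ hnorm, toComplex_apply]
  simp

theorem toCircle_cover_eq_iff {s t : ℝ} :
    toCircle (cover s) = toCircle (cover t) ↔ ∃ m : ℤ, s = t + m := by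
  rw [toCircle_cover, toCircle_cover, Circle.exp_eq_exp]
  refine exists_congr fun m => ?_
  rw [← mul_right_inj' two_pi_pos.ne' (b := s), mul_add, mul_comm (m : ℝ)]

theorem toCircle_injective : Function.Injective toCircle := by
  intro x y h
  obtain ⟨s, rfl⟩ := cover_surjective x
  obtain ⟨t, rfl⟩ := cover_surjective y
  obtain ⟨m, rfl⟩ := toCircle_cover_eq_iff.1 h
  exact mul_one (m : ℝ) ▸ periodic_cover.int_mul m t

theorem toCircle_surjective : Function.Surjective toCircle := by
  intro z
  obtain ⟨t, rfl⟩ := Circle.exp_surjective z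
  exact ⟨cover (t / (2 * π)), by rw [toCircle_cover, mul_div_cancel₀ _ two_pi_pos.ne']⟩

instance : CompactSpace RP1 :=
  ⟨cover_surjective.range_eq ▸ periodic_cover.compact_of_continuous one_ne_zero continuous_cover⟩

/-- The homeomorphism between the real projective line and the circle given by `toCircle`. -/
noncomputable def homeoCircle : RP1 ≃ₜ Circle :=
  continuous_toCircle.homeoOfEquivCompactToT2
    (f := Equiv.ofBijective toCircle ⟨toCircle_injective, toCircle_surjective⟩)

theorem homeoCircle_apply (x : RP1) : homeoCircle x = toCircle x := rfl

theorem toCircle_infty : toCircle infty = 1 := by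
  ext
  simp [infty, coe_toCircle_mk, toComplex_apply]

theorem toCircle_base : toCircle base = Circle.exp (π / 2) := by
  have hbase : base = cover 4⁻¹ := by
    rw [base, cover, Projectivization.mk_eq_mk_iff']
    refine ⟨√2, ?_⟩
    simp [← div_eq_mul_inv, ← mul_div_assoc]
  rw [hbase, toCircle_cover]
  congr 1
  ring

theorem coe_toCircle_affine (x : ℝ) : (toCircle (affine x) : ℂ) = (x + I) / (x - I) := by
  simp [affine, coe_toCircle_mk, toComplex_apply, sub_eq_add_neg]

theorem exists_affine_of_ne_infty {y : RP1} (hy : y ≠ infty) : ∃ x, y = affine x := by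
  obtain ⟨v, hv⟩ := y
  have hv1 : v 1 ≠ 0 := fun h1 => hy <| (Projectivization.mk_eq_mk_iff' ℝ _ _ _ _).2
    ⟨v 0, by ext i; fin_cases i <;> simp [h1]⟩
  refine ⟨v 0 / v 1, (Projectivization.mk_eq_mk_iff' ℝ _ _ _ _).2 ⟨v 1, ?_⟩⟩
  ext i
  fin_cases i <;> simp [mul_div_cancel₀ _ hv1]

/-- Self-maps of the projective line, viewed as self-maps of the circle. -/
noncomputable def mapHomeo : C(RP1, RP1) ≃ₜ C(Circle, Circle) :=
  homeoCircle.arrowCongr homeoCircle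

theorem mapHomeo_toCircle (f : C(RP1, RP1)) (x : RP1) :
    mapHomeo f (toCircle x) = toCircle (f x) := by
  change homeoCircle (f (homeoCircle.symm (homeoCircle x))) = _
  rw [Homeomorph.symm_apply_apply, homeoCircle_apply]

end RP1

section CircleValuedMaps

theorem dist_circleExp (s t : ℝ) :
    dist (Circle.exp s) (Circle.exp t) = ‖2 * sin ((s - t) / 2)‖ := by
  have hfactor : exp (s * I) - exp (t * I) = exp (t * I) * (exp (I * (s - t : ℝ)) - 1) := by
    rw [mul_sub_one, ← Complex.exp_add]
    push_cast
    ring_nf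
  change dist (Circle.exp s : ℂ) (Circle.exp t) = _
  rw [dist_eq_norm, Circle.coe_exp, Circle.coe_exp, hfactor, norm_mul,
    Complex.norm_exp_ofReal_mul_I, one_mul, Complex.norm_exp_I_mul_ofReal_sub_one]

theorem dist_circleExp_le (s t : ℝ) : dist (Circle.exp s) (Circle.exp t) ≤ dist s t := by
  rw [dist_circleExp, norm_mul, Real.norm_ofNat, Real.norm_eq_abs, Real.dist_eq]
  calc 2 * |sin ((s - t) / 2)| ≤ 2 * |(s - t) / 2| :=
        mul_le_mul_of_nonneg_left Real.abs_sin_le_abs two_pos.le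
    _ = |s - t| := by rw [abs_div, abs_two, mul_div_cancel₀ _ two_ne_zero]

theorem dist_le_mul_dist_circleExp {s t : ℝ} (h : dist s t ≤ π) :
    dist s t ≤ π / 2 * dist (Circle.exp s) (Circle.exp t) := by
  rw [Real.dist_eq] at h ⊢
  have hhalf : |(s - t) / 2| = |s - t| / 2 := by rw [abs_div, abs_two]
  have hjordan := Real.mul_abs_le_abs_sin (x := (s - t) / 2) (by rw [hhalf]; gcongr)
  rw [hhalf] at hjordan
  rw [dist_circleExp, norm_mul, Real.norm_ofNat, Real.norm_eq_abs]
  calc |s - t| = π * (2 / π * (|s - t| / 2)) := by field_simp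
    _ ≤ π * |sin ((s - t) / 2)| := by gcongr
    _ = π / 2 * (2 * |sin ((s - t) / 2)|) := by ring

variable {X : Type*} [TopologicalSpace X]

/-- The circle-valued map `x ↦ exp (i u x)` with continuous logarithm `u`. -/
noncomputable def circleExpMap (u : C(X, ℝ)) : C(X, Circle) := Circle.exp.comp u

theorem circleExpMap_apply (u : C(X, ℝ)) (x : X) : circleExpMap u x = Circle.exp (u x) := rfl

variable [CompactSpace X]

theorem dist_circleExpMap_le (u v : C(X, ℝ)) :
    dist (circleExpMap u) (circleExpMap v) ≤ dist u v :=
  (ContinuousMap.dist_le dist_nonneg).2 fun x =>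
    (dist_circleExp_le _ _).trans (ContinuousMap.dist_apply_le_dist x)

variable [PreconnectedSpace X] {u v : C(X, ℝ)} {x₀ : X}

/-- By the intermediate value theorem `u - v` cannot leave `(-π, π)` without the two exponentials
becoming antipodal. -/
theorem dist_apply_lt_pi_of_dist_circleExpMap_lt_two (h₀ : u x₀ = v x₀)
    (h : dist (circleExpMap u) (circleExpMap v) < 2) (x : X) : dist (u x) (v x) < π := by
  by_contra! hx
  obtain ⟨y, hy⟩ : π ∈ Set.range fun x => dist (u x) (v x) :=
    mem_range_of_exists_le_of_exists_ge (by fun_prop)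
      ⟨x₀, by simp [h₀, Real.pi_nonneg]⟩ ⟨x, hx⟩
  have hantipodal : dist (circleExpMap u y) (circleExpMap v y) = 2 := by
    rw [circleExpMap_apply, circleExpMap_apply, dist_circleExp]
    obtain h' | h' : u y - v y = π ∨ u y - v y = -π := by
      rwa [← abs_eq Real.pi_nonneg, ← Real.dist_eq]
    all_goals simp [h', neg_div]
  exact (hantipodal ▸ ContinuousMap.dist_apply_le_dist y).not_gt h

theorem dist_le_mul_dist_circleExpMap (h₀ : u x₀ = v x₀)
    (h : dist (circleExpMap u) (circleExpMap v) < 2) :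
    dist u v ≤ π / 2 * dist (circleExpMap u) (circleExpMap v) := by
  refine (ContinuousMap.dist_le (by positivity)).2 fun x => ?_
  calc dist (u x) (v x) ≤ π / 2 * dist (circleExpMap u x) (circleExpMap v x) :=
        dist_le_mul_dist_circleExp (dist_apply_lt_pi_of_dist_circleExpMap_lt_two h₀ h x).le
    _ ≤ π / 2 * dist (circleExpMap u) (circleExpMap v) := by
        gcongr
        exact ContinuousMap.dist_apply_le_dist x

theorem isClosedEmbedding_circleExpMap (x₀ : X) (c : ℝ) :
    Topology.IsClosedEmbedding fun u : {u : C(X, ℝ) // u x₀ = c} => circleExpMap u.1 := by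
  have hbound : ∀ {u v : {u : C(X, ℝ) // u x₀ = c}},
      dist (circleExpMap u.1) (circleExpMap v.1) < 2 →
        dist u v ≤ π / 2 * dist (circleExpMap u.1) (circleExpMap v.1) :=
    fun {u v} => dist_le_mul_dist_circleExpMap (u.2.trans v.2.symm)
  have : CompleteSpace {u : C(X, ℝ) // u x₀ = c} :=
    (isClosed_eq (continuous_eval_const x₀) continuous_const).completeSpace_coe
  refine (Metric.isUniformEmbedding_iff.2 ⟨fun u v h => ?_, ?_, fun ε hε => ?_⟩).isClosedEmbedding
  · exact dist_le_zero.1 ((hbound (by simp [h])).trans_eq (by simp [h]))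
  · exact (LipschitzWith.of_dist_le' (K := 1) fun u v =>
      (dist_circleExpMap_le u.1 v.1).trans_eq (one_mul _).symm).uniformContinuous
  · refine ⟨min 2 (ε / (π / 2)), by positivity, fun {u v} h => ?_⟩
    refine (hbound (h.trans_le (min_le_left _ _))).trans_lt ?_
    exact (lt_div_iff₀' (by positivity)).1 (h.trans_le (min_le_right _ _))

end CircleValuedMaps

/-- The self-map `z ↦ z ^ d * exp (i u z)` of the circle, which winds `d` times. -/
noncomputable def windingMap (d : ℤ) (u : C(Circle, ℝ)) : C(Circle, Circle) :=
  ContinuousMap.id Circle ^ d * circleExpMap u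

theorem windingMap_apply (d : ℤ) (u : C(Circle, ℝ)) (z : Circle) :
    windingMap d u z = z ^ d * Circle.exp (u z) := rfl

theorem isClosedEmbedding_windingMap (d : ℤ) (z₀ : Circle) (c : ℝ) :
    Topology.IsClosedEmbedding fun u : {u : C(Circle, ℝ) // u z₀ = c} => windingMap d u.1 :=
  (Homeomorph.mulLeft (ContinuousMap.id Circle ^ d)).isClosedEmbedding.comp
    (isClosedEmbedding_circleExpMap z₀ c)

namespace RP1

theorem hasDegree_mapHomeo_symm_windingMap (d : ℤ) (u : C(Circle, ℝ)) :
    HasDegree (mapHomeo.symm (windingMap d u)) d := by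
  refine ⟨fun θ => d * θ + u (Circle.exp (2 * π * θ)) / (2 * π), by fun_prop, fun θ => ?_,
    fun θ => ?_⟩
  · apply toCircle_injective
    rw [← mapHomeo_toCircle, Homeomorph.apply_symm_apply, toCircle_cover, toCircle_cover,
      windingMap_apply, mul_add, mul_div_cancel₀ _ two_pi_pos.ne', Circle.exp_add,
      ← Circle.exp_intCast_mul, mul_left_comm]
  · simp only [mul_add, mul_one, Circle.exp_add_two_pi]
    ring

theorem HasDegree.unique {f : C(RP1, RP1)} {d e : ℤ} (hd : HasDegree f d) (he : HasDegree f e) :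
    d = e := by
  obtain ⟨F, hF, hfF, hFd⟩ := hd
  obtain ⟨G, hG, hfG, hGe⟩ := he
  have hint (θ) : ∃ m : ℤ, F θ = G θ + m :=
    toCircle_cover_eq_iff.1 (by rw [← hfF, ← hfG])
  choose m hm using hint
  have hmcont : Continuous m := by
    rw [Int.isClosedEmbedding_coe_real.isEmbedding.continuous_iff]
    exact (hF.sub hG).congr fun θ => sub_eq_of_eq_add' (hm θ)
  have hmconst : m (0 + 1) = m 0 := PreconnectedSpace.constant inferInstance hmcont
  have hperiod := hm (0 + 1)
  rw [hmconst, hFd, hGe, hm 0] at hperiod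
  exact_mod_cast (by linarith : (d : ℝ) = e)

end RP1

section ClosedUnitDisc

instance : CompactSpace 𝕔𝔻 := isCompact_iff_compactSpace.1 (isCompact_closedBall (0 : ℂ) 1)

instance : T2Space 𝕔𝔻 := Complex.UnitClosedDisc.isEmbedding_coe.t2Space

instance : ContinuousMul 𝕔𝔻 := inferInstanceAs (ContinuousMul (Metric.closedBall (0 : ℂ) 1))

instance : Nontrivial 𝕔𝔻 := ⟨0, 1, by simp [← Complex.UnitClosedDisc.coe_inj]⟩

instance : PathConnectedSpace 𝕔𝔻 :=
  isPathConnected_iff_pathConnectedSpace.1 <|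
    (convex_closedBall (0 : ℂ) 1).isPathConnected ⟨0, by simp⟩

/-- The inclusion of the circle as the boundary of the closed unit disc. -/
noncomputable def circleToDisc : C(Circle, 𝕔𝔻) where
  toFun z := .mk z z.norm_coe.le
  continuous_toFun := Complex.UnitClosedDisc.isEmbedding_coe.continuous_iff.2 continuous_subtype_val

theorem coe_circleToDisc (z : Circle) : (circleToDisc z : ℂ) = z := rfl

theorem circleToDisc_one : circleToDisc 1 = 1 := rfl

/-- The boundary values of a function on the closed unit disc. -/
noncomputable def boundaryValues (U : C(𝕔𝔻, ℝ)) : C(Circle, ℝ) := U.comp circleToDisc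

theorem boundaryValues_apply (U : C(𝕔𝔻, ℝ)) (z : Circle) :
    boundaryValues U z = U (circleToDisc z) := rfl

theorem continuous_boundaryValues : Continuous boundaryValues :=
  circleToDisc.continuous_precomp

/-- Real functions on the closed unit disc that are imaginary parts of functions holomorphic in the
interior and continuous up to the boundary. -/
def imHolomorphic : Submodule ℝ C(𝕔𝔻, ℝ) where
  carrier := {U | ∃ G : ℂ → ℂ, DiffContOnCl ℂ G (Metric.ball 0 1) ∧ ∀ z : 𝕔𝔻, U z = (G z).im}
  zero_mem' := ⟨0, diffContOnCl_const, fun _ => rfl⟩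
  add_mem' := by
    rintro U V ⟨G, hG, hU⟩ ⟨H, hH, hV⟩
    exact ⟨G + H, hG.add hH, fun z => by simp [hU, hV]⟩
  smul_mem' := by
    rintro c U ⟨G, hG, hU⟩
    exact ⟨c • G, hG.const_smul c, fun z => by simp [hU]⟩

theorem const_mem_imHolomorphic (c : ℝ) : ContinuousMap.const 𝕔𝔻 c ∈ imHolomorphic :=
  ⟨fun _ => c * I, diffContOnCl_const, fun _ => by simp⟩

/-- The maximum modulus principle is applied to `exp (-iG)`, whose modulus is `exp (Im G)`. -/
theorem le_of_boundaryValues_le {U : C(𝕔𝔻, ℝ)} (hU : U ∈ imHolomorphic) {C : ℝ}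
    (hC : ∀ z, boundaryValues U z ≤ C) (z : 𝕔𝔻) : U z ≤ C := by
  obtain ⟨G, hG, hUG⟩ := hU
  have hnorm (w : 𝕔𝔻) : ‖exp (-I * G w)‖ = Real.exp (U w) := by
    simp [Complex.norm_exp, hUG]
  have hdiff : DiffContOnCl ℂ (fun w => exp (-I * G w)) (Metric.ball 0 1) :=
    Complex.differentiable_exp.comp_diffContOnCl (hG.const_smul (-I))
  have hfrontier : ∀ w ∈ frontier (Metric.ball (0 : ℂ) 1), ‖exp (-I * G w)‖ ≤ Real.exp C := by
    rw [frontier_ball 0 one_ne_zero]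
    intro w hw
    exact (hnorm (circleToDisc ⟨w, hw⟩)).trans_le (Real.exp_le_exp.2 (hC ⟨w, hw⟩))
  have hz : (z : ℂ) ∈ closure (Metric.ball (0 : ℂ) 1) := by
    rw [closure_ball 0 one_ne_zero]
    exact z.2
  exact Real.exp_le_exp.1 <| (hnorm z).symm.trans_le <|
    Complex.norm_le_of_forall_mem_frontier_norm_le Metric.isBounded_ball hdiff hfrontier hz

theorem norm_boundaryValues_of_mem_imHolomorphic {U : C(𝕔𝔻, ℝ)} (hU : U ∈ imHolomorphic) :
    ‖boundaryValues U‖ = ‖U‖ := by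
  apply le_antisymm
  · exact (ContinuousMap.norm_le _ (norm_nonneg _)).2 fun z => U.norm_coe_le_norm (circleToDisc z)
  · refine (ContinuousMap.norm_le _ (norm_nonneg _)).2 fun z => abs_le'.2 ⟨?_, ?_⟩
    · exact le_of_boundaryValues_le hU
        (fun w => (le_abs_self _).trans ((boundaryValues U).norm_coe_le_norm w)) z
    · exact le_of_boundaryValues_le (neg_mem hU)
        (fun w => (neg_le_abs _).trans ((boundaryValues U).norm_coe_le_norm w)) z

theorem norm_boundaryValues {U : C(𝕔𝔻, ℝ)} (hU : U ∈ imHolomorphic.topologicalClosure) :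
    ‖boundaryValues U‖ = ‖U‖ := by
  have hclosed : IsClosed {U : C(𝕔𝔻, ℝ) | ‖boundaryValues U‖ = ‖U‖} :=
    isClosed_eq continuous_boundaryValues.norm continuous_norm
  rw [← SetLike.mem_coe, Submodule.topologicalClosure_coe] at hU
  exact hclosed.closure_subset_iff.2 (fun _ => norm_boundaryValues_of_mem_imHolomorphic) hU

theorem isClosedEmbedding_windingMap_boundaryValues {F : Set C(𝕔𝔻, ℝ)} (hF : IsClosed F)
    (hFim : F ⊆ imHolomorphic.topologicalClosure) {c : ℝ} (hFc : ∀ U ∈ F, U 1 = c) (d : ℤ) :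
    Topology.IsClosedEmbedding fun U : F => windingMap d (boundaryValues U.1) := by
  have : CompleteSpace F := hF.completeSpace_coe
  have hisom : Isometry fun U : F =>
      (⟨boundaryValues U.1, hFc U U.2⟩ : {u : C(Circle, ℝ) // u 1 = c}) :=
    Isometry.of_dist_eq fun U V => by
      rw [Subtype.dist_eq, Subtype.dist_eq, dist_eq_norm, dist_eq_norm,
        ← norm_boundaryValues (sub_mem (hFim U.2) (hFim V.2))]
      rfl
  have hcomp := (isClosedEmbedding_windingMap d 1 c).comp hisom.isClosedEmbedding
  exact hcomp

end ClosedUnitDisc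

section Dilation

variable {M : Type*} [TopologicalSpace M] [MonoidWithZero M] [ContinuousMul M]

/-- The function `z ↦ U (w z)`, shifted so as to keep its value at `1`. -/
noncomputable def dilate (w : M) (U : C(M, ℝ)) : C(M, ℝ) where
  toFun z := U (w * z) - U w + U 1

theorem dilate_apply (w : M) (U : C(M, ℝ)) (z : M) : dilate w U z = U (w * z) - U w + U 1 := rfl

theorem dilate_zero (U : C(M, ℝ)) : dilate 0 U = ContinuousMap.const M (U 1) := by
  ext z
  simp [dilate_apply]

theorem dilate_one (U : C(M, ℝ)) : dilate 1 U = U := by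
  ext z
  simp [dilate_apply]

theorem continuous_dilate [LocallyCompactSpace M] :
    Continuous fun p : M × C(M, ℝ) => dilate p.1 p.2 := by
  refine ContinuousMap.continuous_of_continuous_uncurry _ ?_
  simp only [Function.uncurry_def, dilate_apply]
  fun_prop

variable [LocallyCompactSpace M] [T1Space M] [Nontrivial M] {S : Set C(M, ℝ)}

theorem dilate_mem_closure [ConnectedSpace M] (hS : ∀ w ≠ 0, ∀ U ∈ S, dilate w U ∈ S) (w : M)
    {U : C(M, ℝ)} (hU : U ∈ closure S) : dilate w U ∈ closure S := by
  have hne : ∀ w ∈ ({0}ᶜ : Set M), dilate w U ∈ closure S := fun w hw =>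
    map_mem_closure (continuous_dilate.comp (Continuous.prodMk_right w)) hU (hS w hw)
  have hclosed : IsClosed {w | dilate w U ∈ closure S} :=
    isClosed_closure.preimage (continuous_dilate.comp (Continuous.prodMk_left U))
  exact hclosed.closure_subset_iff.2 hne (dense_compl_singleton 0 w)

theorem contractibleSpace_closure_of_dilate_mem [PathConnectedSpace M] (hne : S.Nonempty)
    (hS : ∀ w ≠ 0, ∀ U ∈ S, dilate w U ∈ S) {c : ℝ} (hc : ∀ U ∈ closure S, U 1 = c) :
    ContractibleSpace (closure S) := by
  obtain ⟨V, hV⟩ := hne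
  obtain ⟨γ⟩ := PathConnectedSpace.joined (1 : M) 0
  have hconst : ContinuousMap.const M c ∈ closure S := by
    simpa only [dilate_zero, hc V (subset_closure hV)] using
      dilate_mem_closure hS 0 (subset_closure hV)
  have hcont : Continuous fun p : unitInterval × closure S => dilate (γ p.1) p.2.1 :=
    continuous_dilate.comp (f := fun p : unitInterval × closure S => (γ p.1, p.2.1)) (by fun_prop)
  refine (contractible_iff_id_nullhomotopic _).2 ⟨⟨_, hconst⟩, ⟨⟨⟨fun p =>
    ⟨dilate (γ p.1) p.2.1, dilate_mem_closure hS _ p.2.2⟩, by fun_prop⟩, fun U => ?_, fun U => ?_⟩⟩⟩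
  · exact Subtype.ext (by simp [dilate_one])
  · exact Subtype.ext (by simp [dilate_zero, hc U U.2])

end Dilation

section BlaschkeAngle

theorem one_sub_conj_mul_mem_slitPlane (a : 𝔻) {z : ℂ} (hz : ‖z‖ ≤ 1) :
    1 - conj (a : ℂ) * z ∈ Complex.slitPlane := by
  rw [sub_eq_add_neg]
  refine Complex.mem_slitPlane_of_norm_lt_one ?_
  rw [norm_neg, norm_mul, RCLike.norm_conj]
  exact mul_lt_one_of_nonneg_of_lt_one_left (norm_nonneg _) a.norm_lt_one hz

theorem one_sub_conj_mem_slitPlane (a : 𝔻) : 1 - conj (a : ℂ) ∈ Complex.slitPlane := by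
  simpa only [mul_one] using one_sub_conj_mul_mem_slitPlane a norm_one.le

/-- The continuous argument, vanishing at `1`, of the Blaschke factor with zero `a` divided by `z`.
On the circle this quotient has modulus one, and `(z - a) / z` is conjugate to
`1 - conj a * z`. -/
noncomputable def blaschkeArg (a : 𝔻) : C(𝕔𝔻, ℝ) where
  toFun z := 2 * ((1 - conj (a : ℂ)).arg - (1 - conj (a : ℂ) * z).arg)
  continuous_toFun := continuous_const.mul <| continuous_const.sub <|
    continuous_iff_continuousAt.2 fun z =>
      ContinuousAt.comp (f := fun z : 𝕔𝔻 => 1 - conj (a : ℂ) * z)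
        (Complex.continuousAt_arg (one_sub_conj_mul_mem_slitPlane a z.norm_le_one)) (by fun_prop)

theorem blaschkeArg_apply (a : 𝔻) (z : 𝕔𝔻) :
    blaschkeArg a z = 2 * ((1 - conj (a : ℂ)).arg - (1 - conj (a : ℂ) * z).arg) := rfl

theorem blaschkeArg_one (a : 𝔻) : blaschkeArg a 1 = 0 := by simp [blaschkeArg_apply]

theorem blaschkeArg_mul (a : 𝔻) (w z : 𝕔𝔻) :
    blaschkeArg a (w * z) = blaschkeArg (star w • a) z + blaschkeArg a w := by
  simp only [blaschkeArg_apply, Complex.UnitClosedDisc.coe_closedBall_smul,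
    Complex.UnitClosedDisc.coe_star, Complex.UnitClosedDisc.coe_mul, map_mul, Complex.conj_conj]
  ring_nf

theorem blaschkeArg_mem_imHolomorphic (a : 𝔻) : blaschkeArg a ∈ imHolomorphic := by
  refine ⟨fun z => 2 * (Complex.log (1 - conj (a : ℂ)) - Complex.log (1 - conj (a : ℂ) * z)),
    DifferentiableOn.diffContOnCl fun z hz => ?_, fun z => ?_⟩
  · rw [closure_ball 0 one_ne_zero, mem_closedBall_zero_iff] at hz
    have hlog := Complex.differentiableAt_log (one_sub_conj_mul_mem_slitPlane a hz)
    fun_prop (disch := assumption)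
  · simp [blaschkeArg_apply, Complex.log_im, Complex.mul_im]

/-- The continuous argument, taking the value `π / 2` at `1`, of `i` times the quotient of the
Blaschke products with zeros `A` and `B`, divided by the power of `z` that makes the winding number
vanish. -/
noncomputable def blaschkeAngle (A B : Multiset 𝔻) : C(𝕔𝔻, ℝ) :=
  ContinuousMap.const 𝕔𝔻 (π / 2) + (A.map blaschkeArg).sum - (B.map blaschkeArg).sum

theorem blaschkeAngle_apply (A B : Multiset 𝔻) (z : 𝕔𝔻) :
    blaschkeAngle A B z =
      π / 2 + (A.map fun a => blaschkeArg a z).sum - (B.map fun b => blaschkeArg b z).sum := by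
  have hsum (C : Multiset 𝔻) :
      (C.map blaschkeArg).sum z = (C.map fun c => blaschkeArg c z).sum :=
    (map_multiset_sum (ContinuousMap.evalCLM ℝ z) _).trans (by rw [Multiset.map_map]; rfl)
  simp only [blaschkeAngle, ContinuousMap.sub_apply, ContinuousMap.add_apply,
    ContinuousMap.const_apply, hsum]

theorem blaschkeAngle_one (A B : Multiset 𝔻) : blaschkeAngle A B 1 = π / 2 := by
  simp [blaschkeAngle_apply, blaschkeArg_one]

theorem blaschkeAngle_mem_imHolomorphic (A B : Multiset 𝔻) :
    blaschkeAngle A B ∈ imHolomorphic := by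
  have hsum (C : Multiset 𝔻) : (C.map blaschkeArg).sum ∈ imHolomorphic :=
    multiset_sum_mem _ <| Multiset.forall_mem_map_iff.2 fun c _ => blaschkeArg_mem_imHolomorphic c
  exact sub_mem (add_mem (const_mem_imHolomorphic _) (hsum A)) (hsum B)

theorem dilate_blaschkeAngle (w : 𝕔𝔻) (A B : Multiset 𝔻) :
    dilate w (blaschkeAngle A B) =
      blaschkeAngle (A.map (star w • ·)) (B.map (star w • ·)) := by
  ext z
  rw [dilate_apply, blaschkeAngle_one]
  simp only [blaschkeAngle_apply, blaschkeArg_mul, Multiset.sum_map_add, Multiset.map_map,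
    Function.comp_def]
  ring

/-- The angle functions of the quotients of Blaschke products without common zeros, `n` being the
total number of zeros and `d` the winding number. -/
def angleFunctions (n : ℕ) (d : ℤ) : Set C(𝕔𝔻, ℝ) :=
  {U | ∃ A B : Multiset 𝔻, Disjoint A B ∧ A.card + B.card = n ∧ (A.card : ℤ) - B.card = d ∧
    blaschkeAngle A B = U}

theorem angleFunctions_nonempty {n : ℕ} {d : ℤ} (hnd : -(n : ℤ) ≤ d) (hdn : d ≤ n)
    (hmod : d ≡ n [ZMOD 2]) : (angleFunctions n d).Nonempty := by
  obtain ⟨k, l, rfl, rfl⟩ : ∃ k l : ℕ, k + l = n ∧ (k : ℤ) - l = d :=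
    ⟨((n + d) / 2).toNat, ((n - d) / 2).toNat, by have := hmod.eq; omega,
      by have := hmod.eq; omega⟩
  obtain ⟨a, ha⟩ : ∃ a : 𝔻, a ≠ 0 := ⟨.mk (1 / 2) (by norm_num), by simp⟩
  refine ⟨_, Multiset.replicate k 0, Multiset.replicate l a, ?_, by simp, by simp, rfl⟩
  rw [Multiset.disjoint_left]
  rintro b hb hb'
  exact ha ((Multiset.eq_of_mem_replicate hb').symm.trans (Multiset.eq_of_mem_replicate hb))

theorem degree_bounds_of_mem_angleFunctions {n : ℕ} {d : ℤ} {U : C(𝕔𝔻, ℝ)}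
    (hU : U ∈ angleFunctions n d) : -(n : ℤ) ≤ d ∧ d ≤ n ∧ d ≡ n [ZMOD 2] := by
  obtain ⟨A, B, -, hn, hd, -⟩ := hU
  rw [Int.ModEq]
  omega

theorem star_smul_injective {w : 𝕔𝔻} (hw : w ≠ 0) : Function.Injective fun a : 𝔻 => star w • a := by
  intro a b hab
  have hw' : conj (w : ℂ) ≠ 0 := by simpa using hw
  simpa [← Complex.UnitDisc.coe_inj, hw'] using hab

theorem dilate_mem_angleFunctions {n : ℕ} {d : ℤ} {w : 𝕔𝔻} (hw : w ≠ 0) {U : C(𝕔𝔻, ℝ)}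
    (hU : U ∈ angleFunctions n d) : dilate w U ∈ angleFunctions n d := by
  obtain ⟨A, B, hAB, hn, hd, rfl⟩ := hU
  refine ⟨A.map (star w • ·), B.map (star w • ·), Multiset.disjoint_map_map.2 ?_, by simpa,
    by simpa, (dilate_blaschkeAngle w A B).symm⟩
  intro a ha b hb hab
  obtain rfl := star_smul_injective hw hab
  exact Multiset.disjoint_left.1 hAB ha hb

theorem apply_one_of_mem_closure_angleFunctions {n : ℕ} {d : ℤ} {U : C(𝕔𝔻, ℝ)}
    (hU : U ∈ closure (angleFunctions n d)) : U 1 = π / 2 := by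
  have hclosed : IsClosed {U : C(𝕔𝔻, ℝ) | U 1 = π / 2} :=
    isClosed_eq (continuous_eval_const 1) continuous_const
  refine hclosed.closure_subset_iff.2 ?_ hU
  rintro _ ⟨A, B, -, -, -, rfl⟩
  exact blaschkeAngle_one A B

theorem closure_angleFunctions_subset (n : ℕ) (d : ℤ) :
    closure (angleFunctions n d) ⊆ imHolomorphic.topologicalClosure := by
  rw [Submodule.topologicalClosure_coe]
  refine closure_mono ?_
  rintro _ ⟨A, B, -, -, -, rfl⟩
  exact blaschkeAngle_mem_imHolomorphic A B

theorem contractibleSpace_closure_angleFunctions {n : ℕ} {d : ℤ} (hnd : -(n : ℤ) ≤ d) (hdn : d ≤ n)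
    (hmod : d ≡ n [ZMOD 2]) : ContractibleSpace (closure (angleFunctions n d)) :=
  contractibleSpace_closure_of_dilate_mem (angleFunctions_nonempty hnd hdn hmod)
    (fun _ hw _ => dilate_mem_angleFunctions hw)
    fun _ => apply_one_of_mem_closure_angleFunctions

theorem isClosedEmbedding_windingMap_angleFunctions (n : ℕ) (d : ℤ) :
    Topology.IsClosedEmbedding fun U : closure (angleFunctions n d) =>
      windingMap d (boundaryValues U.1) :=
  isClosedEmbedding_windingMap_boundaryValues isClosed_closure (closure_angleFunctions_subset n d)
    (fun _ => apply_one_of_mem_closure_angleFunctions) d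

end BlaschkeAngle

section Complexify

/-- The complex polynomial `(p + iq) / (1 + i)`, a complex encoding of the pair `(p, q)` that is
monic when `p` and `q` are monic of the same degree. -/
noncomputable def complexify (p q : ℝ[X]) : ℂ[X] :=
  Polynomial.C ((1 - I) / 2) * p.map Complex.ofRealHom +
    Polynomial.C ((1 + I) / 2) * q.map Complex.ofRealHom

theorem coeff_complexify (p q : ℝ[X]) (i : ℕ) :
    (complexify p q).coeff i = (1 - I) / 2 * p.coeff i + (1 + I) / 2 * q.coeff i := by
  simp [complexify]

theorem coeff_complexify_eq_ofReal_iff (p q : ℝ[X]) (i : ℕ) (t : ℝ) :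
    (complexify p q).coeff i = t ↔ p.coeff i = t ∧ q.coeff i = t := by
  have hcoeff : (complexify p q).coeff i =
      ⟨(p.coeff i + q.coeff i) / 2, (q.coeff i - p.coeff i) / 2⟩ := by
    rw [coeff_complexify, Complex.mk_eq_add_mul_I]
    push_cast
    ring
  rw [hcoeff, Complex.ext_iff, Complex.ofReal_re, Complex.ofReal_im]
  grind

theorem isMonicOfDegree_complexify_iff {p q : ℝ[X]} {n : ℕ} :
    (complexify p q).IsMonicOfDegree n ↔ p.IsMonicOfDegree n ∧ q.IsMonicOfDegree n := by
  have hzero (i) := coeff_complexify_eq_ofReal_iff p q i 0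
  have hone (i) := coeff_complexify_eq_ofReal_iff p q i 1
  simp only [Complex.ofReal_zero, Complex.ofReal_one] at hzero hone
  simp only [Polynomial.isMonicOfDegree_iff, Polynomial.natDegree_le_iff_coeff_eq_zero, hzero, hone]
  grind

theorem complexify_surjective (H : ℂ[X]) : ∃ p q, complexify p q = H := by
  induction H using Polynomial.induction_on' with
  | add H H' h h' =>
    obtain ⟨p, q, rfl⟩ := h
    obtain ⟨p', q', rfl⟩ := h'
    refine ⟨p + p', q + q', ?_⟩
    simp only [complexify, Polynomial.map_add]
    ring
  | monomial n c =>
    refine ⟨.monomial n (c.re - c.im), .monomial n (c.re + c.im), ?_⟩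
    simp only [complexify, Polynomial.map_monomial, Polynomial.C_mul_monomial, ← map_add]
    congr 1
    rw [Complex.ofRealHom_eq_coe, Complex.ofRealHom_eq_coe]
    push_cast
    linear_combination Complex.re_add_im c

theorem eval_complexify (p q : ℝ[X]) (c : ℂ) :
    (complexify p q).eval c =
      (1 - I) / 2 * Polynomial.aeval c p + (1 + I) / 2 * Polynomial.aeval c q := by
  simp only [complexify, Polynomial.eval_add, Polynomial.eval_mul, Polynomial.eval_C,
    Polynomial.eval_map]
  rfl

theorem conj_eval_complexify_conj (p q : ℝ[X]) (c : ℂ) :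
    conj ((complexify p q).eval (conj c)) =
      (1 + I) / 2 * Polynomial.aeval c p + (1 - I) / 2 * Polynomial.aeval c q := by
  rw [eval_complexify, Polynomial.aeval_conj, Polynomial.aeval_conj]
  simp [sub_eq_add_neg, map_ofNat (starRingEnd ℂ)]

theorem eval_complexify_eq_zero_and (p q : ℝ[X]) (c : ℂ) :
    (complexify p q).eval c = 0 ∧ (complexify p q).eval (conj c) = 0 ↔
      Polynomial.aeval c p = 0 ∧ Polynomial.aeval c q = 0 := by
  rw [← map_eq_zero (starRingEnd ℂ) (a := (complexify p q).eval (conj c)),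
    conj_eval_complexify_conj, eval_complexify]
  constructor
  · rintro ⟨h, h'⟩
    constructor
    · linear_combination (1 + I) / 2 * h + (1 - I) / 2 * h' +
        (Polynomial.aeval c p - Polynomial.aeval c q) / 2 * Complex.I_sq
    · linear_combination (1 - I) / 2 * h + (1 + I) / 2 * h' +
        (Polynomial.aeval c q - Polynomial.aeval c p) / 2 * Complex.I_sq
  · rintro ⟨h, h'⟩
    simp [h, h']

theorem isCoprime_iff_conj_notMem_roots {p q : ℝ[X]} (h : complexify p q ≠ 0) :
    IsCoprime p q ↔ ∀ c ∈ (complexify p q).roots, conj c ∉ (complexify p q).roots := by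
  refine (Polynomial.isCoprime_iff_aeval_ne_zero_of_isAlgClosed ℝ ℂ p q).trans ?_
  refine forall_congr' fun c => ?_
  rw [← not_and_or, ← eval_complexify_eq_zero_and, Polynomial.mem_roots h, Polynomial.mem_roots h,
    not_and]
  rfl

theorem vec_eval_ne_zero {p q : ℝ[X]} (h : IsCoprime p q) (x : ℝ) :
    (![p.eval x, q.eval x] : Fin 2 → ℝ) ≠ 0 := by
  intro h0
  obtain ⟨a, b, hab⟩ := h
  have hp : p.eval x = 0 := congrFun h0 0
  have hq : q.eval x = 0 := congrFun h0 1
  simpa [hp, hq] using congrArg (Polynomial.eval x) hab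

theorem coe_toCircle_mk_eval {p q : ℝ[X]} (h : (complexify p q).Monic) (x : ℝ)
    (hx : (![p.eval x, q.eval x] : Fin 2 → ℝ) ≠ 0) :
    (RP1.toCircle (Projectivization.mk ℝ ![p.eval x, q.eval x] hx) : ℂ) =
      I * ((complexify p q).roots.map fun c => ((x : ℂ) - c) / (x - conj c)).prod := by
  have hvec : RP1.toComplex ![p.eval x, q.eval x] = (1 + I) * (complexify p q).eval (x : ℂ) := by
    have hreal (r : ℝ[X]) : Polynomial.aeval (x : ℂ) r = r.eval x :=
      Polynomial.aeval_algebraMap_apply ℂ x r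
    rw [RP1.toComplex_apply, eval_complexify, hreal, hreal, Matrix.cons_val_zero,
      Matrix.cons_val_one, Matrix.cons_val_zero]
    linear_combination (2⁻¹ * (p.eval x - q.eval x : ℂ)) * Complex.I_sq
  have hI : (1 + I) / conj (1 + I) = I := by
    rw [div_eq_iff (by simp [Complex.ext_iff]), map_add, map_one, Complex.conj_I]
    linear_combination Complex.I_sq
  rw [RP1.coe_toCircle_mk, hvec, map_mul, mul_div_mul_comm, hI,
    (IsAlgClosed.splits _).eval_eq_prod_roots_of_monic h, Multiset.prod_map_div, map_multiset_prod,
    Multiset.map_map]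
  simp only [Function.comp_def, map_sub, Complex.conj_ofReal]

end Complexify

section BlaschkeFactor

theorem exp_neg_two_mul_arg {w : ℂ} (hw : w ≠ 0) : exp (-2 * w.arg * I) = conj w / w := by
  have hsq : w = ‖w‖ * exp (w.arg * I) := (Complex.norm_mul_exp_arg_mul_I w).symm
  have hconj : conj w = ‖w‖ * exp (-(w.arg * I)) := by
    conv_lhs => rw [hsq]
    rw [map_mul, Complex.conj_ofReal, ← Complex.exp_conj, map_mul, Complex.conj_ofReal,
      Complex.conj_I, mul_neg]
  have hnorm : (‖w‖ : ℂ) ≠ 0 := by simpa using hw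
  calc exp (-2 * w.arg * I) = exp (-(w.arg * I) - w.arg * I) := by ring_nf
    _ = ‖w‖ * exp (-(w.arg * I)) / (‖w‖ * exp (w.arg * I)) := by
      rw [Complex.exp_sub, mul_div_mul_left _ _ hnorm]
    _ = conj w / w := by rw [← hconj, ← hsq]

/-- The Blaschke factor with zero `a` on the circle, normalized to take the value `1` at `1`. -/
noncomputable def blaschkeFactor (a : 𝔻) (z : Circle) : Circle :=
  z * Circle.exp (blaschkeArg a (circleToDisc z))

theorem coe_blaschkeFactor (a : 𝔻) (z : Circle) :
    (blaschkeFactor a z : ℂ) = (z - a) / (1 - conj (a : ℂ) * z) *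
      ((1 - conj (a : ℂ)) / (1 - a)) := by
  have hz := Complex.slitPlane_ne_zero (one_sub_conj_mul_mem_slitPlane a z.norm_coe.le)
  have hone := Complex.slitPlane_ne_zero (one_sub_conj_mem_slitPlane a)
  have hone' : 1 - (a : ℂ) ≠ 0 := by simpa using (map_ne_zero (starRingEnd ℂ)).2 hone
  have hangle : ((blaschkeArg a (circleToDisc z) : ℝ) : ℂ) * I =
      -2 * (1 - conj (a : ℂ) * z).arg * I - -2 * (1 - conj (a : ℂ)).arg * I := by
    rw [blaschkeArg_apply, coe_circleToDisc]
    push_cast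
    ring
  have hinv : conj (z : ℂ) = (z : ℂ)⁻¹ := by rw [← Circle.coe_inv_eq_conj, Circle.coe_inv]
  rw [blaschkeFactor, Circle.coe_mul, Circle.coe_exp, hangle, Complex.exp_sub,
    exp_neg_two_mul_arg hz, exp_neg_two_mul_arg hone]
  simp only [map_sub, map_mul, map_one, Complex.conj_conj, hinv]
  have hz0 := z.coe_ne_zero
  field_simp

theorem prod_map_blaschkeFactor (A : Multiset 𝔻) (z : Circle) :
    (A.map fun a => blaschkeFactor a z).prod =
      z ^ A.card * Circle.exp (A.map fun a => blaschkeArg a (circleToDisc z)).sum := by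
  induction A using Multiset.induction with
  | empty => simp
  | cons a A ih =>
    rw [Multiset.map_cons, Multiset.prod_cons, ih, Multiset.map_cons, Multiset.sum_cons,
      Circle.exp_add, blaschkeFactor, Multiset.card_cons, pow_succ', mul_mul_mul_comm]

theorem windingMap_blaschkeAngle (A B : Multiset 𝔻) (z : Circle) :
    windingMap ((A.card : ℤ) - B.card) (boundaryValues (blaschkeAngle A B)) z =
      Circle.exp (π / 2) * ((A.map fun a => blaschkeFactor a z).prod /
        (B.map fun b => blaschkeFactor b z).prod) := by
  rw [windingMap_apply, boundaryValues_apply, blaschkeAngle_apply, prod_map_blaschkeFactor,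
    prod_map_blaschkeFactor, Circle.exp_sub, Circle.exp_add, zpow_sub, zpow_natCast, zpow_natCast,
    mul_div_mul_comm, ← div_eq_mul_inv, mul_div_assoc, mul_left_comm]

end BlaschkeFactor

section RootsOfZeros

theorem norm_sub_I_lt_norm_add_I (c : ℍ) : ‖(c : ℂ) - I‖ < ‖(c : ℂ) + I‖ := by
  rw [Complex.norm_def, Complex.norm_def]
  refine Real.sqrt_lt_sqrt (Complex.normSq_nonneg _) ?_
  have him := c.im_pos
  simp only [Complex.normSq_apply, Complex.sub_re, Complex.add_re, Complex.sub_im, Complex.add_im,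
    Complex.I_re, Complex.I_im, UpperHalfPlane.coe_im]
  linarith

theorem im_I_mul_div_pos (a : 𝔻) : 0 < (I * (1 + conj (a : ℂ)) / (1 - conj (a : ℂ))).im := by
  have hden := Complex.normSq_pos.2 (Complex.slitPlane_ne_zero (one_sub_conj_mem_slitPlane a))
  have him : (I * (1 + conj (a : ℂ)) / (1 - conj (a : ℂ))).im =
      (1 - Complex.normSq a) / Complex.normSq (1 - conj (a : ℂ)) := by
    rw [Complex.div_im, ← sub_div]
    congr 1
    simp only [Complex.mul_re, Complex.mul_im, Complex.I_re, Complex.I_im, Complex.add_re,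
      Complex.add_im, Complex.sub_re, Complex.sub_im, Complex.one_re, Complex.one_im,
      Complex.conj_re, Complex.conj_im, Complex.normSq_apply]
    ring
  rw [him]
  exact div_pos (sub_pos.2 a.normSq_lt_one) hden

/-- The affine coordinate of the pole of the Blaschke factor with zero `a`. The zero itself has the
conjugate coordinate. -/
noncomputable def blaschkePole : 𝔻 ≃ ℍ where
  toFun a := ⟨I * (1 + conj (a : ℂ)) / (1 - conj (a : ℂ)), im_I_mul_div_pos a⟩
  invFun c := star <| .mk ((c - I) / (c + I)) <| by
    rw [norm_div, div_lt_one ((norm_nonneg _).trans_lt (norm_sub_I_lt_norm_add_I c))]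
    exact norm_sub_I_lt_norm_add_I c
  left_inv a := by
    have hden := Complex.slitPlane_ne_zero (one_sub_conj_mem_slitPlane a)
    rw [star_eq_iff_star_eq, ← Complex.UnitDisc.coe_inj]
    simp only [Complex.UnitDisc.coe_star, Complex.UnitDisc.coe_mk]
    field_simp
    ring
  right_inv c := by
    have hden : (c : ℂ) + I ≠ 0 :=
      norm_pos_iff.1 ((norm_nonneg _).trans_lt (norm_sub_I_lt_norm_add_I c))
    rw [← UpperHalfPlane.coe_inj]
    simp only [Complex.UnitDisc.coe_star, Complex.UnitDisc.coe_mk, map_div₀, map_sub, map_add,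
      Complex.conj_conj, Complex.conj_I, map_neg, neg_neg, sub_neg_eq_add]
    field_simp
    ring

theorem coe_blaschkePole (a : 𝔻) :
    (blaschkePole a : ℂ) = I * (1 + conj (a : ℂ)) / (1 - conj (a : ℂ)) := rfl

theorem ofReal_sub_ne_zero_of_im_ne_zero {c : ℂ} (hc : c.im ≠ 0) (x : ℝ) : (x : ℂ) - c ≠ 0 := by
  rw [sub_ne_zero]
  rintro rfl
  exact hc (Complex.ofReal_im x)

theorem coe_blaschkeFactor_toCircle_affine (a : 𝔻) (x : ℝ) :
    (blaschkeFactor a (RP1.toCircle (RP1.affine x)) : ℂ) =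
      (x - conj (blaschkePole a : ℂ)) / (x - blaschkePole a) := by
  have hone := Complex.slitPlane_ne_zero (one_sub_conj_mem_slitPlane a)
  have hone' : 1 - (a : ℂ) ≠ 0 := by simpa using (map_ne_zero (starRingEnd ℂ)).2 hone
  have hI : (x : ℂ) - I ≠ 0 := ofReal_sub_ne_zero_of_im_ne_zero (by simp) x
  have hpole : (x : ℂ) - blaschkePole a ≠ 0 :=
    ofReal_sub_ne_zero_of_im_ne_zero (blaschkePole a).im_pos.ne' x
  have hz := Complex.slitPlane_ne_zero
    (one_sub_conj_mul_mem_slitPlane a (RP1.toCircle (RP1.affine x)).norm_coe.le)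
  rw [coe_blaschkeFactor, div_mul_div_comm, div_eq_div_iff (mul_ne_zero hz hone') hpole,
    RP1.coe_toCircle_affine, coe_blaschkePole]
  simp only [map_div₀, map_mul, map_add, map_sub, map_one, Complex.conj_I, Complex.conj_conj]
  field_simp
  ring

/-- The affine coordinates of the zeros of the quotient of the Blaschke products with zeros `A` and
`B` which lie in the half-planes: the zeros `A` in the lower one, the poles of `B` in the upper
one. -/
noncomputable def rootsOfZeros (A B : Multiset 𝔻) : Multiset ℂ :=
  (A.map fun a => conj (blaschkePole a : ℂ)) + B.map fun b => (blaschkePole b : ℂ)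

theorem card_rootsOfZeros (A B : Multiset 𝔻) : (rootsOfZeros A B).card = A.card + B.card := by
  simp [rootsOfZeros]

theorem conj_notMem_rootsOfZeros_iff {A B : Multiset 𝔻} :
    (∀ c ∈ rootsOfZeros A B, conj c ∉ rootsOfZeros A B) ↔ Disjoint A B := by
  have hupper (a b : 𝔻) : (blaschkePole a : ℂ) ≠ conj (blaschkePole b : ℂ) := fun h => by
    have him : (blaschkePole a).im = -(blaschkePole b).im := by simpa using congrArg Complex.im h
    linarith [(blaschkePole a).im_pos, (blaschkePole b).im_pos]
  have hinj (a b : 𝔻) : (blaschkePole a : ℂ) = blaschkePole b ↔ a = b := by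
    rw [UpperHalfPlane.coe_inj, blaschkePole.injective.eq_iff]
  have hinj' (a b : 𝔻) : conj (blaschkePole a : ℂ) = conj (blaschkePole b : ℂ) ↔ a = b := by
    rw [(starRingEnd ℂ).injective.eq_iff, hinj]
  simp only [rootsOfZeros, Multiset.mem_add, Multiset.mem_map, Multiset.disjoint_left]
  constructor
  · intro h a ha hb
    exact h _ (.inl ⟨a, ha, rfl⟩) (.inr ⟨a, hb, (Complex.conj_conj _).symm⟩)
  · rintro h _ (⟨a, ha, rfl⟩ | ⟨b, hb, rfl⟩) (⟨a', ha', h'⟩ | ⟨b', hb', h'⟩)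
    · exact hupper a a' (h'.trans (Complex.conj_conj _)).symm
    · exact h ha ((hinj b' a).1 (h'.trans (Complex.conj_conj _)) ▸ hb')
    · exact h ha' ((hinj' a' b).1 h' ▸ hb)
    · exact hupper b' b h'

theorem exists_rootsOfZeros_eq {s : Multiset ℂ} (hs : ∀ c ∈ s, c.im ≠ 0) :
    ∃ A B, rootsOfZeros A B = s := by
  induction s using Multiset.induction with
  | empty => exact ⟨0, 0, rfl⟩
  | cons c s ih =>
    obtain ⟨A, B, rfl⟩ := ih fun c hc => hs c (Multiset.mem_cons_of_mem hc)
    obtain hlower | hupper := (hs c (Multiset.mem_cons_self _ _)).lt_or_gt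
    · refine ⟨blaschkePole.symm ⟨conj c, by simpa using hlower⟩ ::ₘ A, B, ?_⟩
      simp [rootsOfZeros]
    · refine ⟨A, blaschkePole.symm ⟨c, hupper⟩ ::ₘ B, ?_⟩
      simp [rootsOfZeros]

theorem windingMap_blaschkeAngle_toCircle_affine (A B : Multiset 𝔻) (x : ℝ) :
    (windingMap ((A.card : ℤ) - B.card) (boundaryValues (blaschkeAngle A B))
        (RP1.toCircle (RP1.affine x)) : ℂ) =
      I * ((rootsOfZeros A B).map fun c => ((x : ℂ) - c) / (x - conj c)).prod := by
  have hcoe (C : Multiset 𝔻) :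
      (((C.map fun c => blaschkeFactor c (RP1.toCircle (RP1.affine x))).prod : Circle) : ℂ) =
        (C.map fun c => ((x : ℂ) - conj (blaschkePole c : ℂ)) / (x - blaschkePole c)).prod := by
    refine (map_multiset_prod Circle.coeHom _).trans ?_
    rw [Multiset.map_map]
    exact congrArg _ (Multiset.map_congr rfl fun c _ => coe_blaschkeFactor_toCircle_affine c x)
  have hI : (Circle.exp (π / 2) : ℂ) = I := by
    rw [Circle.coe_exp, Complex.ofReal_div, Complex.ofReal_ofNat, Complex.exp_pi_div_two_mul_I]
  rw [windingMap_blaschkeAngle, Circle.coe_mul, hI, Circle.coe_div, hcoe, hcoe, rootsOfZeros,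
    Multiset.map_add, Multiset.prod_add, Multiset.map_map, Multiset.map_map, div_eq_mul_inv,
    ← Multiset.prod_map_inv]
  simp only [Function.comp_def, Complex.conj_conj, inv_div]

end RootsOfZeros

section RationalMaps

theorem RP1.range_mapHomeo_val :
    Set.range (fun f : LoopRP1 => RP1.mapHomeo f.1) = {g | g 1 = Circle.exp (π / 2)} := by
  ext g
  constructor
  · rintro ⟨f, rfl⟩
    rw [Set.mem_ofPred_eq, ← RP1.toCircle_infty, RP1.mapHomeo_toCircle, f.2, RP1.toCircle_base]
  · intro hg
    have hbase : RP1.mapHomeo.symm g RP1.infty = RP1.base := by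
      apply RP1.toCircle_injective
      rw [← RP1.mapHomeo_toCircle, Homeomorph.apply_symm_apply, RP1.toCircle_infty,
        RP1.toCircle_base]
      exact hg
    exact ⟨⟨RP1.mapHomeo.symm g, hbase⟩, RP1.mapHomeo.apply_symm_apply g⟩

theorem RP1.isClosedEmbedding_mapHomeo_val :
    Topology.IsClosedEmbedding fun f : LoopRP1 => RP1.mapHomeo f.1 := by
  refine ⟨RP1.mapHomeo.isEmbedding.comp .subtypeVal, ?_⟩
  rw [RP1.range_mapHomeo_val]
  exact isClosed_eq (continuous_eval_const 1) continuous_const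

theorem windingMap_boundaryValues_one (d : ℤ) (U : C(𝕔𝔻, ℝ)) :
    windingMap d (boundaryValues U) 1 = Circle.exp (U 1) := by
  rw [windingMap_apply, one_zpow, one_mul, boundaryValues_apply, circleToDisc_one]

theorem RP1.mapHomeo_eq_iff {f : LoopRP1} {g : C(Circle, Circle)}
    (hg : g 1 = Circle.exp (π / 2)) :
    RP1.mapHomeo f.1 = g ↔
      ∀ x, RP1.toCircle (f.1 (RP1.affine x)) = g (RP1.toCircle (RP1.affine x)) := by
  constructor
  · rintro rfl x
    exact (RP1.mapHomeo_toCircle _ _).symm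
  · intro h
    ext1 z
    obtain ⟨y, rfl⟩ := RP1.toCircle_surjective z
    rw [RP1.mapHomeo_toCircle]
    obtain rfl | hy := eq_or_ne y RP1.infty
    · rw [f.2, RP1.toCircle_base, RP1.toCircle_infty, hg]
    · obtain ⟨x, rfl⟩ := RP1.exists_affine_of_ne_infty hy
      exact h x

theorem mem_realRat_iff_exists_roots {n : ℕ} {f : LoopRP1} :
    f ∈ realRat n ↔ ∃ s : Multiset ℂ, s.card = n ∧ (∀ c ∈ s, conj c ∉ s) ∧
      ∀ x : ℝ, (RP1.toCircle (f.1 (RP1.affine x)) : ℂ) =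
        I * (s.map fun c => ((x : ℂ) - c) / (x - conj c)).prod := by
  constructor
  · rintro ⟨p, q, hp, hq, hpn, hqn, hpq, hf⟩
    obtain ⟨hdeg, hmonic⟩ := isMonicOfDegree_complexify_iff.2 ⟨⟨hpn, hp⟩, ⟨hqn, hq⟩⟩
    refine ⟨(complexify p q).roots, ?_, (isCoprime_iff_conj_notMem_roots hmonic.ne_zero).1 hpq,
      fun x => ?_⟩
    · rw [← (IsAlgClosed.splits _).natDegree_eq_card_roots, hdeg]
    · obtain ⟨hx, hfx⟩ := hf x
      rw [hfx, coe_toCircle_mk_eval hmonic]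
  · rintro ⟨s, rfl, hs, hf⟩
    obtain ⟨p, q, hH⟩ := complexify_surjective (s.map fun c => Polynomial.X - Polynomial.C c).prod
    have hroots : (complexify p q).roots = s := by
      rw [hH, Polynomial.roots_multiset_prod_X_sub_C]
    have hmonic : (complexify p q).Monic := by
      rw [hH]
      exact Polynomial.monic_multiset_prod_of_monic _ _ fun c _ => Polynomial.monic_X_sub_C c
    have hdeg : (complexify p q).natDegree = s.card := by
      rw [(IsAlgClosed.splits _).natDegree_eq_card_roots, hroots]
    obtain ⟨hp, hq⟩ := isMonicOfDegree_complexify_iff.1 ⟨hdeg, hmonic⟩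
    have hpq := (isCoprime_iff_conj_notMem_roots hmonic.ne_zero).2 (hroots.symm ▸ hs)
    refine ⟨p, q, hp.monic, hq.monic, hp.natDegree_eq, hq.natDegree_eq, hpq, fun x =>
      ⟨vec_eval_ne_zero hpq x, RP1.toCircle_injective (Circle.ext ?_)⟩⟩
    rw [hf, coe_toCircle_mk_eval hmonic, hroots]

theorem mem_realRat_iff {n : ℕ} {f : LoopRP1} :
    f ∈ realRat n ↔
      ∃ d, ∃ U ∈ angleFunctions n d, RP1.mapHomeo f.1 = windingMap d (boundaryValues U) := by
  have hiff (A B : Multiset 𝔻) :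
      RP1.mapHomeo f.1 = windingMap ((A.card : ℤ) - B.card) (boundaryValues (blaschkeAngle A B)) ↔
        ∀ x : ℝ, (RP1.toCircle (f.1 (RP1.affine x)) : ℂ) =
          I * ((rootsOfZeros A B).map fun c => ((x : ℂ) - c) / (x - conj c)).prod := by
    rw [RP1.mapHomeo_eq_iff (by rw [windingMap_boundaryValues_one, blaschkeAngle_one])]
    simp only [← windingMap_blaschkeAngle_toCircle_affine, Circle.coe_inj]
  rw [mem_realRat_iff_exists_roots]
  constructor
  · rintro ⟨s, hn, hs, hf⟩
    obtain ⟨A, B, rfl⟩ := exists_rootsOfZeros_eq (s := s) fun c hc h0 =>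
      hs c hc (by rwa [Complex.conj_eq_iff_im.2 h0])
    rw [card_rootsOfZeros] at hn
    exact ⟨_, _, ⟨A, B, conj_notMem_rootsOfZeros_iff.1 hs, hn, rfl, rfl⟩, (hiff A B).2 hf⟩
  · rintro ⟨_, _, ⟨A, B, hAB, hn, rfl, rfl⟩, hf⟩
    exact ⟨rootsOfZeros A B, (card_rootsOfZeros A B).trans hn,
      conj_notMem_rootsOfZeros_iff.2 hAB, (hiff A B).1 hf⟩

theorem closure_image_angleFunctions (n : ℕ) (d : ℤ) :
    closure ((fun U => windingMap d (boundaryValues U)) '' angleFunctions n d) =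
      (fun U => windingMap d (boundaryValues U)) '' closure (angleFunctions n d) := by
  have hemb := isClosedEmbedding_windingMap_angleFunctions n d
  apply subset_antisymm
  · refine closure_minimal (Set.image_mono subset_closure) ?_
    rw [Set.image_eq_range]
    exact hemb.isClosed_range
  · exact (continuousOn_iff_continuous_domRestrict.2 hemb.continuous).image_closure

theorem windingMap_mem_range_mapHomeo_val {n : ℕ} {d : ℤ} {U : C(𝕔𝔻, ℝ)}
    (hU : U ∈ closure (angleFunctions n d)) :
    windingMap d (boundaryValues U) ∈ Set.range fun f : LoopRP1 => RP1.mapHomeo f.1 := by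
  rw [RP1.range_mapHomeo_val, Set.mem_ofPred_eq, windingMap_boundaryValues_one,
    apply_one_of_mem_closure_angleFunctions hU]

theorem image_mapHomeo_realRat (n : ℕ) :
    (fun f : LoopRP1 => RP1.mapHomeo f.1) '' realRat n =
      ⋃ d : ℤ, (fun U => windingMap d (boundaryValues U)) '' angleFunctions n d := by
  ext g
  simp only [Set.mem_iUnion]
  constructor
  · rintro ⟨f, hf, rfl⟩
    obtain ⟨d, U, hU, hfU⟩ := mem_realRat_iff.1 hf
    exact ⟨d, U, hU, hfU.symm⟩
  · rintro ⟨d, U, hU, rfl⟩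
    obtain ⟨f, hf⟩ := windingMap_mem_range_mapHomeo_val (subset_closure hU)
    exact ⟨f, mem_realRat_iff.2 ⟨d, U, hU, hf⟩, hf⟩

theorem finite_setOf_angleFunctions_nonempty (n : ℕ) :
    {d : ℤ | (angleFunctions n d).Nonempty}.Finite :=
  (Set.finite_Icc (-(n : ℤ)) n).subset fun _ ⟨_, hU⟩ =>
    have hd := degree_bounds_of_mem_angleFunctions hU
    ⟨hd.1, hd.2.1⟩

theorem mem_ratClosure_iff {n : ℕ} {f : LoopRP1} :
    f ∈ ratClosure n ↔ ∃ d, ∃ U ∈ closure (angleFunctions n d),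
      RP1.mapHomeo f.1 = windingMap d (boundaryValues U) := by
  have hlocfin : LocallyFinite fun d : ℤ =>
      (fun U => windingMap d (boundaryValues U)) '' angleFunctions n d := fun g =>
    ⟨Set.univ, Filter.univ_mem, by
      simpa only [Set.inter_univ, Set.image_nonempty] using
        finite_setOf_angleFunctions_nonempty n⟩
  rw [ratClosure, ← RP1.isClosedEmbedding_mapHomeo_val.injective.mem_set_image,
    ← RP1.isClosedEmbedding_mapHomeo_val.closure_image_eq, image_mapHomeo_realRat,
    hlocfin.closure_iUnion]
  simp only [closure_image_angleFunctions, Set.mem_iUnion, Set.mem_image, eq_comm]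

end RationalMaps

section Degree

open RP1 (HasDegree mapHomeo)

theorem RP1.hasDegree_of_mapHomeo_eq {f : C(RP1, RP1)} {d : ℤ} {u : C(Circle, ℝ)}
    (h : mapHomeo f = windingMap d u) : HasDegree f d := by
  rw [← mapHomeo.symm_apply_apply f, h]
  exact RP1.hasDegree_mapHomeo_symm_windingMap d u

theorem exists_hasDegree_of_mem_ratClosure {n : ℕ} (f : ratClosure n) :
    ∃ d : {d : ℤ // -(n : ℤ) ≤ d ∧ d ≤ n ∧ d ≡ n [ZMOD 2]}, HasDegree f.1.1 d := by
  obtain ⟨d, U, hU, hf⟩ := mem_ratClosure_iff.1 f.2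
  obtain ⟨V, hV⟩ := closure_nonempty_iff.1 ⟨U, hU⟩
  exact ⟨⟨d, degree_bounds_of_mem_angleFunctions hV⟩, RP1.hasDegree_of_mapHomeo_eq hf⟩

theorem hasDegree_iff_mem_range {n : ℕ} {d : ℤ} {f : ratClosure n} :
    HasDegree f.1.1 d ↔ mapHomeo f.1.1 ∈
      Set.range fun U : closure (angleFunctions n d) => windingMap d (boundaryValues U.1) := by
  constructor
  · intro hd
    obtain ⟨e, U, hU, hf⟩ := mem_ratClosure_iff.1 f.2
    obtain rfl := (RP1.hasDegree_of_mapHomeo_eq hf).unique hd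
    exact ⟨⟨U, hU⟩, hf.symm⟩
  · rintro ⟨U, hU⟩
    exact RP1.hasDegree_of_mapHomeo_eq hU.symm

theorem isClosed_hasDegree (n : ℕ) (d : ℤ) :
    IsClosed {f : ratClosure n | HasDegree f.1.1 d} := by
  simp only [hasDegree_iff_mem_range]
  exact (isClosedEmbedding_windingMap_angleFunctions n d).isClosed_range.preimage
    (RP1.isClosedEmbedding_mapHomeo_val.continuous.comp continuous_subtype_val)

theorem range_mapHomeo_hasDegree (n : ℕ) (d : ℤ) :
    Set.range (fun f : {f : ratClosure n | HasDegree f.1.1 d} => mapHomeo f.1.1.1) =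
      Set.range fun U : closure (angleFunctions n d) => windingMap d (boundaryValues U.1) := by
  apply subset_antisymm
  · rintro _ ⟨f, rfl⟩
    exact hasDegree_iff_mem_range.1 f.2
  · rintro _ ⟨U, rfl⟩
    obtain ⟨f, hf⟩ := windingMap_mem_range_mapHomeo_val U.2
    exact ⟨⟨⟨f, mem_ratClosure_iff.2 ⟨d, U, U.2, hf⟩⟩, RP1.hasDegree_of_mapHomeo_eq hf⟩, hf⟩

theorem contractibleSpace_hasDegree {n : ℕ} {d : ℤ} (hnd : -(n : ℤ) ≤ d) (hdn : d ≤ n)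
    (hmod : d ≡ n [ZMOD 2]) : ContractibleSpace {f : ratClosure n | HasDegree f.1.1 d} := by
  have hemb : Topology.IsEmbedding
      fun f : {f : ratClosure n | HasDegree f.1.1 d} => mapHomeo f.1.1.1 :=
    RP1.isClosedEmbedding_mapHomeo_val.isEmbedding.comp
      (Topology.IsEmbedding.subtypeVal.comp .subtypeVal)
  have hΦ := (isClosedEmbedding_windingMap_angleFunctions n d).isEmbedding
  have := contractibleSpace_closure_angleFunctions hnd hdn hmod
  exact (hemb.toHomeomorph.trans ((Homeomorph.setCongr (range_mapHomeo_hasDegree n d)).trans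
    hΦ.toHomeomorph.symm)).contractibleSpace

theorem card_degrees (n : ℕ) :
    Nat.card {d : ℤ // -(n : ℤ) ≤ d ∧ d ≤ n ∧ d ≡ n [ZMOD 2]} = n + 1 := by
  have hbij : Function.Bijective fun k : Fin (n + 1) =>
      (⟨2 * k - n, by rw [Int.ModEq]; omega⟩ :
        {d : ℤ // -(n : ℤ) ≤ d ∧ d ≤ n ∧ d ≡ n [ZMOD 2]}) := by
    constructor
    · intro k l hkl
      have hval : (2 * k - n : ℤ) = 2 * l - n := congrArg Subtype.val hkl
      ext
      omega
    · rintro ⟨d, hnd, hdn, hmod⟩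
      have hparity : d % 2 = n % 2 := hmod
      have hval : (2 * ((d + n) / 2).toNat - n : ℤ) = d := by omega
      exact ⟨⟨((d + n) / 2).toNat, by omega⟩, Subtype.ext hval⟩
  rw [← Nat.card_eq_of_bijective _ hbij, Nat.card_fin]

end Degree

section ConnectedComponents

variable {X D : Type*} [TopologicalSpace X] {δ : X → D}

theorem isLocallyConstant_of_isClosed_fiber [Finite D] (h : ∀ d, IsClosed {x | δ x = d}) :
    IsLocallyConstant δ := by
  intro s
  have hcompl : (δ ⁻¹' s)ᶜ = ⋃ d ∈ sᶜ, {x | δ x = d} := by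
    ext x
    simp
  rw [← isClosed_compl_iff, hcompl]
  exact sᶜ.toFinite.isClosed_biUnion fun d _ => h d

theorem connectedComponent_eq_fiber (hδ : IsLocallyConstant δ) {x : X}
    (hx : IsPreconnected {y | δ y = δ x}) : connectedComponent x = {y | δ y = δ x} :=
  subset_antisymm
    (fun _ hy => hδ.apply_eq_of_isPreconnected isPreconnected_connectedComponent hy
      mem_connectedComponent)
    (hx.subset_connectedComponent rfl)

theorem exists_connectedComponents_equiv (hδ : IsLocallyConstant δ)
    (hconn : ∀ d, IsConnected {x | δ x = d}) :
    ∃ e : ConnectedComponents X ≃ D, ∀ x, e (ConnectedComponents.mk x) = δ x := by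
  have hfiber (x y : X) : connectedComponent x = connectedComponent y ↔ δ x = δ y := by
    rw [connectedComponent_eq_iff_mem, connectedComponent_eq_fiber hδ (hconn _).isPreconnected,
      Set.mem_ofPred_eq]
  refine ⟨Equiv.ofBijective (Quotient.lift δ fun x y => (hfiber x y).1) ⟨?_, fun d => ?_⟩,
    fun x => rfl⟩
  · rintro ⟨x⟩ ⟨y⟩ hxy
    exact Quotient.sound ((hfiber x y).2 hxy)
  · obtain ⟨x, hx⟩ := (hconn d).nonempty
    exact ⟨ConnectedComponents.mk x, hx⟩

end ConnectedComponents

theorem mainTheorem2 (n : ℕ) :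
    Nat.card (ConnectedComponents (ratClosure n)) = n + 1 ∧
    (∃ e : ConnectedComponents (ratClosure n) ≃ {d : ℤ // -(n : ℤ) ≤ d ∧ d ≤ n ∧ d ≡ n [ZMOD 2]},
      ∀ (f : ratClosure n) (d : ℤ),
        RP1.HasDegree f.1.1 d ↔ ((e (ConnectedComponents.mk f) : ℤ) = d)) ∧
    ∀ f : ratClosure n, ContractibleSpace (connectedComponent f) := by
  choose δ hδ using exists_hasDegree_of_mem_ratClosure (n := n)
  have hdegree (f d) : RP1.HasDegree f.1.1 d ↔ (δ f : ℤ) = d :=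
    ⟨fun h => (hδ f).unique h, fun h => h ▸ hδ f⟩
  have hfiber (d) : {f | δ f = d} = {f : ratClosure n | RP1.HasDegree f.1.1 d} := by
    simp only [hdegree, Subtype.ext_iff]
  have : Finite {d : ℤ // -(n : ℤ) ≤ d ∧ d ≤ n ∧ d ≡ n [ZMOD 2]} :=
    Nat.finite_of_card_ne_zero (by simp [card_degrees])
  have hlocconst : IsLocallyConstant δ :=
    isLocallyConstant_of_isClosed_fiber fun d => hfiber d ▸ isClosed_hasDegree n d
  have hcontr (d) : ContractibleSpace {f | δ f = d} :=
    hfiber d ▸ contractibleSpace_hasDegree d.2.1 d.2.2.1 d.2.2.2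
  have hconn (d) : IsConnected {f | δ f = d} :=
    isConnected_iff_connectedSpace.2 inferInstance
  obtain ⟨e, he⟩ := exists_connectedComponents_equiv hlocconst hconn
  refine ⟨by rw [Nat.card_congr e, card_degrees], ⟨e, fun f d => by rw [he, hdegree]⟩, fun f => ?_⟩
  rw [connectedComponent_eq_fiber hlocconst (hconn _).isPreconnected]
  exact hcontr (δ f)
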